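/- Consider a slotted link whose channel state $s[n]\in\{1,\dots,S\}$, $S\ge 1$, is an ergodic (irreducible, aperiodic) Markov chain with transition matrix $P$. In each slot $n\ge 1$ a packet arrives ($b[n]=1$) with probability $\theta\in[0,1)$, independently over slots and of the channel, and otherwise $b[n]=0$. The transmitter then chooses $a[n]\in\{0,1\}$, where sending ($a[n]=1$) in channel state $s$ costs power $X_s\ge 0$, and $X_1>X_2>\dots>X_S$. With a buffer of size $K$ the queue length evolves as $$l[n]=\max\{\min\{l[n-1]+b[n],K\}-a[n],\,0\}.$$ A non-anticipating policy chooses $a[n]$, possibly at random, from the past and from the current $l[n-1]+b[n]$ and $s[n]$. Fix $\eta\ge 0$ and $\mathcal{E}\in\mathbb{R}$, and consider the unconstrained problem $$\min_{\pi}\ \lim_{N\to\infty}\frac1N\,\mathbb{E}_\pi\Big[\sum_{n=1}^N \big(l[n]+\eta\,(a[n]X_{s[n]}-\mathcal{E})\big)\Big].$$ Then there are finite thresholds $L_s\in\mathbb{N}$, one for each channel state $s$, such that for every sufficiently large buffer size $K$ (including the unlimited buffer $K=\infty$) the following deterministic stationary policy is optimal for this problem: in slot $n$, with $s[n]=s$,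 it transmits ($a[n]=1$) if $l[n-1]+b[n]\ge L_s$, and otherwise idles ($a[n]=0$). Optimal means that from every initial state $(l[0],s[0])$ with $l[0]\le K$ the average cost of this policy converges to a finite limit, and this limit is at most the lower limit $\liminf_{N\to\infty}$ of the average cost of every non-anticipating policy from the same initial state. -/

import Mathlib

open Filter Topology

/-- A slotted point-to-point link: an ergodic channel chain with `S ≥ 1` states, Bernoulli
arrivals, and the transmission power needed in each channel state (a larger index is a better
channel, hence needs strictly less power). -/
structure LinkModel (S : ℕ) where
  /-- there is at least one channel state -/
  channels_pos : 0 < S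
  /-- `P i j` is the probability that the channel moves from state `i` to state `j` -/
  P : Matrix (Fin S) (Fin S) ℝ
  stochastic : P ∈ Matrix.rowStochastic ℝ (Fin S)
  /-- ergodicity (irreducible and aperiodic): some power of `P` has only positive entries -/
  ergodic : P.IsPrimitive
  /-- the probability of a packet arrival in a slot -/
  θ : ℝ
  θ_nonneg : 0 ≤ θ
  θ_lt_one : θ < 1
  /-- the power needed for a transmission in each channel state -/
  X : Fin S → ℝ
  X_nonneg : ∀ s, 0 ≤ X s
  X_strictAnti : StrictAnti X

/-- What happens in one slot: the channel state `s[n]`, whether a packet arrives (`b[n] = 1`),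
and whether the transmitter sends (`a[n] = 1`). -/
abbrev Slot (S : ℕ) : Type := Fin S × Bool × Bool

/-- `max {min {l + b, K} - a, 0}` for a buffer of capacity `K`, where `K = ⊤` is an unlimited
buffer (the subtraction is the truncated one of `ℕ`). -/
noncomputable def queueStep (K : ℕ∞) (l b a : ℕ) : ℕ :=
  (min ((l + b : ℕ) : ℕ∞) K).toNat - a

/-- The queue length `l[n]` at the end of the slots in `h` (oldest slot first), from `l[0] = l₀`. -/
noncomputable def queueAfter {S : ℕ} (K : ℕ∞) (l₀ : ℕ) (h : List (Slot S)) : ℕ :=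
  h.foldl (fun l x => queueStep K l x.2.1.toNat x.2.2.toNat) l₀

/-- The channel state in the last slot of `h`, or `s[0] = s₀` if no slot has passed. -/
def channelAfter {S : ℕ} (s₀ : Fin S) (h : List (Slot S)) : Fin S :=
  h.foldl (fun _ x => x.1) s₀

/-- A non-anticipating (history-dependent, randomized) policy: the probability of sending in the
current slot, given all previous slots, the current backlog `q = l[n-1] + b[n]` and the current
channel state `s[n]`. -/
abbrev Policy (S : ℕ) : Type := List (Slot S) → ℕ → Fin S → unitInterval

/-- The deterministic stationary policy that sends at backlog `q` and channel state `s` exactly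
when `f q s = true`. -/
def Policy.ofRule {S : ℕ} (f : ℕ → Fin S → Bool) : Policy S :=
  fun _ q s => if f q s then 1 else 0

namespace LinkModel

variable {S : ℕ} (M : LinkModel S) (K : ℕ∞)

/-- The conditional probability that the next slot is `x`, given that the slots so far were `h`:
the channel moves, a packet arrives or not independently of everything else, and then the
transmitter acts according to `π`. -/
noncomputable def stepProb (π : Policy S) (l₀ : ℕ) (s₀ : Fin S) (h : List (Slot S))
    (x : Slot S) : ℝ :=
  let p : ℝ := π h (queueAfter K l₀ h + x.2.1.toNat) x.1
  M.P (channelAfter s₀ h) x.1 * (if x.2.1 then M.θ else 1 - M.θ) * (if x.2.2 then p else 1 - p)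

/-- The probability, under `π` and from `(l[0], s[0]) = (l₀, s₀)`, that the slots `1, …, N` are
`ω 0, …, ω (N - 1)`. -/
noncomputable def pathProb (π : Policy S) (l₀ : ℕ) (s₀ : Fin S) {N : ℕ}
    (ω : Fin N → Slot S) : ℝ :=
  ∏ n : Fin N, M.stepProb K π l₀ s₀ ((List.ofFn ω).take n) (ω n)

/-- The total cost `∑ n, (l[n] + η (a[n] X_{s[n]} - 𝓔))` of the slots `1, …, N` along `ω`. -/
noncomputable def pathCost (η 𝓔 : ℝ) (l₀ : ℕ) {N : ℕ} (ω : Fin N → Slot S) : ℝ :=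
  ∑ n : Fin N, ((queueAfter K l₀ ((List.ofFn ω).take (n + 1)) : ℝ)
    + η * ((if (ω n).2.2 then M.X (ω n).1 else 0) - 𝓔))

/-- The expected average cost per slot over the slots `1, …, N`. -/
noncomputable def avgCost (η 𝓔 : ℝ) (π : Policy S) (l₀ : ℕ) (s₀ : Fin S) (N : ℕ) : ℝ :=
  (∑ ω : Fin N → Slot S, M.pathProb K π l₀ s₀ ω * M.pathCost K η 𝓔 l₀ ω) / N

/-- `π` is optimal for the long-run average cost: from every initial state its average cost
converges to a finite limit, and no non-anticipating policy has a smaller long-run average cost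
(not even in the sense of the lower limit, taken in the extended reals). -/
def IsAverageOptimal (η 𝓔 : ℝ) (π : Policy S) : Prop :=
  ∀ (l₀ : ℕ) (s₀ : Fin S), (l₀ : ℕ∞) ≤ K →
    ∃ J : ℝ, Tendsto (M.avgCost K η 𝓔 π l₀ s₀) atTop (𝓝 J) ∧
      ∀ π' : Policy S,
        (J : EReal) ≤ liminf (fun N => (M.avgCost K η 𝓔 π' l₀ s₀ N : EReal)) atTop

end LinkModel

/-! The vanishing discount method yields, for the unlimited buffer, a constant `g` and a function
`h`, convex and increasing in the queue length and bounded below, that solve the average cost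
optimality equation (`exists_average_cost_equation`). Sending at backlog `q` is worthwhile when `η
X_s ≤ 1 + h q s - h (q - 1) s`; convexity makes this a threshold condition. The increments of `h`
grow at least linearly (`le_increment`), so the thresholds are finite.

Two drift arguments show that `g - η 𝓔` is the optimal cost for all large buffers at once. Along the
threshold rule `h` is a potential for every `K`, since overflow only shortens the queue and `h` is
monotone; as `h` is bounded below, this bounds the cost from above. For the lower bound `h` does not
serve: it is unbounded, and its expectation under an arbitrary policy is not controlled. It is
replaced by `truncValue`, which is bounded above, evaluated along a virtual queue of fixed capacity
`n + 2` that starts empty and sees the same slots. The real queue dominates the virtual one, and `n`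
is so large that idling at a full virtual buffer does not pay. -/

namespace LinkModel

variable {S : ℕ} (M : LinkModel S)

/-! ### One-slot operators and preservation of convexity -/

/-- The expectation of `G (l + b[n+1]) s[n+1]` given `l[n] = l` and `s[n] = s`. -/
noncomputable def expect (G : ℕ → Fin S → ℝ) (l : ℕ) (s : Fin S) : ℝ :=
  ∑ t, M.P s t * (M.θ * G (l + 1) t + (1 - M.θ) * G l t)

/-- The smaller one of the costs of sending and of idling at backlog `q` and channel state `s`,
if ending the slot with queue length `l` entails the future cost `H l s`. -/
noncomputable def stage (η : ℝ) (H : ℕ → Fin S → ℝ) (q : ℕ) (s : Fin S) : ℝ :=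
  min (η * M.X s + (((q - 1 : ℕ) : ℝ) + H (q - 1) s)) (q + H q s)

/-- The dynamic programming operator with discount factor `α`. -/
noncomputable def bellman (η α : ℝ) (H : ℕ → Fin S → ℝ) : ℕ → Fin S → ℝ :=
  M.expect (M.stage η fun l s => α * H l s)

/-- Monotone and convex in the queue length. -/
structure MonoConvex (H : ℕ → Fin S → ℝ) : Prop where
  mono : ∀ l s, H l s ≤ H (l + 1) s
  convex : ∀ l s, 2 * H (l + 1) s ≤ H l s + H (l + 2) s

theorem P_nonneg (s t : Fin S) : 0 ≤ M.P s t := M.ergodic.nonneg s t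

theorem sum_P (s : Fin S) : ∑ t, M.P s t = 1 :=
  Matrix.sum_row_of_mem_rowStochastic M.stochastic s

theorem expect_mono {G G' : ℕ → Fin S → ℝ} {l l' : ℕ} (s : Fin S)
    (h0 : ∀ t, G l t ≤ G' l' t) (h1 : ∀ t, G (l + 1) t ≤ G' (l' + 1) t) :
    M.expect G l s ≤ M.expect G' l' s := by
  have hθ := M.θ_nonneg
  have hθ' := sub_nonneg.2 M.θ_lt_one.le
  unfold expect
  gcongr with t
  · exact M.P_nonneg s t
  · exact h1 t
  · exact h0 t

theorem expect_le {G : ℕ → Fin S → ℝ} {l : ℕ} (s : Fin S) {c₀ c₁ : ℝ}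
    (h0 : ∀ t, G l t ≤ c₀) (h1 : ∀ t, G (l + 1) t ≤ c₁) :
    M.expect G l s ≤ M.θ * c₁ + (1 - M.θ) * c₀ := by
  have hθ := M.θ_nonneg
  have hθ' := sub_nonneg.2 M.θ_lt_one.le
  calc M.expect G l s ≤ ∑ t, M.P s t * (M.θ * c₁ + (1 - M.θ) * c₀) := by
        unfold expect
        gcongr with t
        · exact M.P_nonneg s t
        · exact h1 t
        · exact h0 t
    _ = _ := by rw [← Finset.sum_mul, M.sum_P, one_mul]

theorem le_expect {G : ℕ → Fin S → ℝ} {l : ℕ} (s : Fin S) {c₀ c₁ : ℝ}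
    (h0 : ∀ t, c₀ ≤ G l t) (h1 : ∀ t, c₁ ≤ G (l + 1) t) :
    M.θ * c₁ + (1 - M.θ) * c₀ ≤ M.expect G l s := by
  have hθ := M.θ_nonneg
  have hθ' := sub_nonneg.2 M.θ_lt_one.le
  calc _ = ∑ t, M.P s t * (M.θ * c₁ + (1 - M.θ) * c₀) := by
        rw [← Finset.sum_mul, M.sum_P, one_mul]
    _ ≤ M.expect G l s := by
        unfold expect
        gcongr with t
        · exact M.P_nonneg s t
        · exact h1 t
        · exact h0 t

theorem expect_sub (G : ℕ → Fin S → ℝ) (k l : ℕ) (s : Fin S) :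
    M.expect G (l + k) s - M.expect G l s
      = M.expect (fun q t => G (q + k) t - G q t) l s := by
  simp only [expect, ← Finset.sum_sub_distrib]
  refine Finset.sum_congr rfl fun t _ => ?_
  rw [show l + k + 1 = l + 1 + k by omega]
  ring

theorem expect_add_const (G : ℕ → Fin S → ℝ) (c : ℝ) (l : ℕ) (s : Fin S) :
    M.expect (fun q t => G q t + c) l s = M.expect G l s + c := by
  have : c = ∑ t, M.P s t * c := by rw [← Finset.sum_mul, M.sum_P, one_mul]
  conv_rhs => rw [this]
  simp only [expect, ← Finset.sum_add_distrib]
  exact Finset.sum_congr rfl fun t _ => by ring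

theorem MonoConvex.expect {M : LinkModel S} {G : ℕ → Fin S → ℝ} (hG : MonoConvex G) :
    MonoConvex (M.expect G) where
  mono l s := M.expect_mono s (fun t => hG.mono l t) (fun t => hG.mono (l + 1) t)
  convex l s := by
    have h := M.expect_mono (G := fun q t => G (q + 1) t - G q t)
      (G' := fun q t => G (q + 1) t - G q t) (l := l) (l' := l + 1) s
      (fun t => by have := hG.convex l t; simp only [add_assoc, Nat.reduceAdd]; linarith)
      (fun t => by have := hG.convex (l + 1) t; simp only [add_assoc, Nat.reduceAdd] at *; linarith)
    rw [← expect_sub, ← expect_sub, add_assoc] at h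
    linarith

variable {η : ℝ}

theorem stage_le_send (η : ℝ) (H : ℕ → Fin S → ℝ) (q : ℕ) (s : Fin S) :
    M.stage η H q s ≤ η * M.X s + (((q - 1 : ℕ) : ℝ) + H (q - 1) s) := min_le_left _ _

theorem stage_le_idle (η : ℝ) (H : ℕ → Fin S → ℝ) (q : ℕ) (s : Fin S) :
    M.stage η H q s ≤ q + H q s := min_le_right _ _

theorem stage_mono {H H' : ℕ → Fin S → ℝ} (h : ∀ l s, H l s ≤ H' l s) (q : ℕ) (s : Fin S) :
    M.stage η H q s ≤ M.stage η H' q s := by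
  unfold stage
  gcongr
  · exact h _ s
  · exact h _ s

/-- A minimum of convex functions need not be convex, but here one branch is the other shifted by
one and raised by a constant. For convexity, the optimal actions at `q` and `q + 2` are fixed; each
of the four cases bounds the value at `q + 1` by suitable actions there. -/
theorem MonoConvex.stage {M : LinkModel S} (hη : 0 ≤ η) {H : ℕ → Fin S → ℝ} (hH : MonoConvex H) :
    MonoConvex (M.stage η H) where
  mono q s := by
    have hc := mul_nonneg hη (M.X_nonneg s)
    refine le_min ?_ ?_
    · rcases q with _ | q
      · have := M.stage_le_idle η H 0 s
        simp only [zero_add, Nat.sub_self]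
        linarith
      · have := M.stage_le_send η H (q + 1) s
        have := hH.mono q s
        simp only [Nat.add_sub_cancel] at *
        push_cast
        linarith
    · have := M.stage_le_idle η H q s
      have := hH.mono q s
      push_cast
      linarith
  convex q s := by
    have hc := mul_nonneg hη (M.X_nonneg s)
    have h1 := M.stage_le_send η H (q + 1) s
    have h2 := M.stage_le_idle η H (q + 1) s
    have hq := hH.convex q s
    have h0 : M.stage η H q s = η * M.X s + (((q - 1 : ℕ) : ℝ) + H (q - 1) s) ∨
      M.stage η H q s = q + H q s := min_choice _ _
    have h3 : M.stage η H (q + 2) s = η * M.X s + (((q + 1 : ℕ) : ℝ) + H (q + 1) s) ∨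
      M.stage η H (q + 2) s = ((q + 2 : ℕ) : ℝ) + H (q + 2) s := min_choice _ _
    simp only [Nat.add_sub_cancel] at h1
    push_cast at h1 h2 h3
    -- At `q = 0` sending removes nothing, so the shift degenerates and the nonnegative sending cost
    -- takes its place.
    rcases q with _ | q
    · simp only [zero_add, Nat.zero_sub, Nat.cast_zero] at *
      rcases h0 with h0 | h0 <;> rcases h3 with h3 | h3 <;> linarith
    · have hq' := hH.convex q s
      simp only [Nat.add_sub_cancel, add_assoc, Nat.reduceAdd] at *
      push_cast at *
      rcases h0 with h0 | h0 <;> rcases h3 with h3 | h3 <;> linarith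

theorem MonoConvex.const_mul {H : ℕ → Fin S → ℝ} (hH : MonoConvex H) {α : ℝ} (hα : 0 ≤ α) :
    MonoConvex fun l s => α * H l s where
  mono l s := mul_le_mul_of_nonneg_left (hH.mono l s) hα
  convex l s := by
    have := mul_le_mul_of_nonneg_left (hH.convex l s) hα
    linarith

theorem MonoConvex.bellman {M : LinkModel S} (hη : 0 ≤ η) {α : ℝ} (hα : 0 ≤ α)
    {H : ℕ → Fin S → ℝ} (hH : MonoConvex H) : MonoConvex (M.bellman η α H) :=
  ((hH.const_mul hα).stage hη).expect

theorem MonoConvex.monotone {H : ℕ → Fin S → ℝ} (hH : MonoConvex H) (s : Fin S) :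
    Monotone fun l => H l s := monotone_nat_of_le_succ fun l => hH.mono l s

theorem isClosed_monoConvex : IsClosed {H : ℕ → Fin S → ℝ | MonoConvex H} := by
  have : {H : ℕ → Fin S → ℝ | MonoConvex H} = {H | ∀ l s, H l s ≤ H (l + 1) s} ∩
      {H | ∀ l s, 2 * H (l + 1) s ≤ H l s + H (l + 2) s} := by
    ext H
    exact ⟨fun h => ⟨h.1, h.2⟩, fun h => ⟨h.1, h.2⟩⟩
  rw [this]
  simp only [Set.ofPred_forall]
  refine (isClosed_iInter fun l => isClosed_iInter fun s => ?_).inter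
    (isClosed_iInter fun l => isClosed_iInter fun s => ?_)
  · exact isClosed_le (by fun_prop) (by fun_prop)
  · exact isClosed_le (by fun_prop) (by fun_prop)

theorem continuous_bellman (η : ℝ) :
    Continuous fun p : ℝ × (ℕ → Fin S → ℝ) => M.bellman η p.1 p.2 := by
  refine continuous_pi fun l => continuous_pi fun s => ?_
  unfold bellman expect stage
  fun_prop

theorem bellman_mono {α : ℝ} (hα : 0 ≤ α) {H H' : ℕ → Fin S → ℝ} (h : H ≤ H') :
    M.bellman η α H ≤ M.bellman η α H' := fun _ s =>
  M.expect_mono s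
    (fun t => M.stage_mono (fun l s => mul_le_mul_of_nonneg_left (h l s) hα) _ t)
    (fun t => M.stage_mono (fun l s => mul_le_mul_of_nonneg_left (h l s) hα) _ t)

/-! ### Discounted problem and bounds uniform in the discount factor -/

/-- A bound on the cost of a transmission. -/
noncomputable def sendCost (η : ℝ) : ℝ := η * ∑ s, M.X s

theorem sendCost_nonneg (hη : 0 ≤ η) : 0 ≤ M.sendCost η :=
  mul_nonneg hη (Finset.sum_nonneg fun s _ => M.X_nonneg s)

theorem mul_X_le_sendCost (hη : 0 ≤ η) (s : Fin S) : η * M.X s ≤ M.sendCost η :=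
  mul_le_mul_of_nonneg_left
    (Finset.single_le_sum (f := M.X) (fun s _ => M.X_nonneg s) (Finset.mem_univ s)) hη

/-- Existence of a discounted value function: the limit of value iteration from `0`. -/
theorem exists_discounted (hη : 0 ≤ η) {α : ℝ} (hα : 0 ≤ α) (hα1 : α < 1) :
    ∃ V : ℕ → Fin S → ℝ, MonoConvex V ∧ (∀ l s, 0 ≤ V l s) ∧
      (∀ l s, (1 - α) * V l s ≤ l + M.sendCost η) ∧ M.bellman η α V = V := by
  set c := M.sendCost η with hc
  have hc0 := M.sendCost_nonneg hη
  have hα' : 0 < 1 - α := sub_pos.2 hα1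
  -- Always sending never lets the queue exceed `l`, so each slot costs at most `l + c`; this gives
  -- a supersolution dominating value iteration.
  let U : ℕ → Fin S → ℝ := fun l _ => (l + c) / (1 - α)
  let W : ℕ → ℕ → Fin S → ℝ := fun n => (M.bellman η α)^[n] 0
  have hW : ∀ n, W (n + 1) = M.bellman η α (W n) := fun n => Function.iterate_succ_apply' _ _ _
  have hreg : ∀ n, MonoConvex (W n) := by
    intro n
    induction n with
    | zero => exact ⟨fun _ _ => le_rfl, fun _ _ => by simp [W]⟩
    | succ n ih => rw [hW]; exact ih.bellman hη hα
  have h01 : W 0 ≤ W 1 := by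
    intro l s
    rw [hW]
    have h := M.le_expect (G := M.stage η fun l s => α * W 0 l s) (l := l) s
      (c₀ := 0) (c₁ := 0) ?_ ?_
    · simpa [W, bellman] using h
    all_goals
      intro t
      have := mul_nonneg hη (M.X_nonneg t)
      refine le_min ?_ ?_ <;> simp only [W, Function.iterate_zero, id, Pi.zero_apply, mul_zero] <;>
        positivity
  have hmono : Monotone W := by
    refine monotone_nat_of_le_succ fun n => ?_
    induction n with
    | zero => exact h01
    | succ n ih => rw [hW, hW (n + 1)]; exact M.bellman_mono hα ih
  have hTU : M.bellman η α U ≤ U := by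
    intro l s
    have hU : ∀ l : ℕ, (l : ℝ) + c + α * ((l + c) / (1 - α)) = (l + c) / (1 - α) := by
      intro l
      field_simp
      ring
    have h := M.expect_le (G := M.stage η fun l s => α * U l s) (l := l) s
      (c₀ := (l + c) / (1 - α)) (c₁ := (l + c) / (1 - α)) ?_ ?_
    · exact h.trans (by simp only [U]; linarith)
    · intro t
      refine (M.stage_le_send _ _ _ _).trans ?_
      have h1 : ((l - 1 : ℕ) : ℝ) ≤ l := by exact_mod_cast Nat.sub_le l 1
      have h2 := M.mul_X_le_sendCost hη t
      have h3 : α * (((l - 1 : ℕ) + c) / (1 - α)) ≤ α * ((l + c) / (1 - α)) := by gcongr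
      have := hU l
      simp only [U]
      linarith
    · intro t
      refine (M.stage_le_send _ _ _ _).trans ?_
      have h2 := M.mul_X_le_sendCost hη t
      have := hU l
      simp only [U, Nat.add_sub_cancel]
      linarith
  have hle : ∀ n, W n ≤ U := by
    intro n
    induction n with
    | zero => intro l s; simp only [W, U, Function.iterate_zero, id, Pi.zero_apply]; positivity
    | succ n ih => rw [hW]; exact (M.bellman_mono hα ih).trans hTU
  let V : ℕ → Fin S → ℝ := fun l s => ⨆ n, W n l s
  have hlim : Tendsto W atTop (𝓝 V) := by
    refine tendsto_pi_nhds.2 fun l => tendsto_pi_nhds.2 fun s => ?_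
    exact tendsto_atTop_ciSup (fun m n h => hmono h l s)
      ⟨U l s, Set.forall_mem_range.2 fun n => hle n l s⟩
  refine ⟨V, isClosed_monoConvex.mem_of_tendsto hlim (Eventually.of_forall hreg), ?_, ?_, ?_⟩
  · intro l s
    exact ge_of_tendsto' (tendsto_pi_nhds.1 (tendsto_pi_nhds.1 hlim l) s)
      fun n => hmono (Nat.zero_le n) l s
  · intro l s
    have : V l s ≤ U l s := le_of_tendsto' (tendsto_pi_nhds.1 (tendsto_pi_nhds.1 hlim l) s)
      fun n => hle n l s
    rw [le_div_iff₀ hα'] at this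
    linarith
  · have h1 : Tendsto (fun n => W (n + 1)) atTop (𝓝 (M.bellman η α V)) := by
      simp only [hW]
      exact (((M.continuous_bellman η).comp (Continuous.prodMk_right α)).tendsto V).comp hlim
    exact tendsto_nhds_unique h1 (hlim.comp (tendsto_add_atTop_nat 1))

/-- If `v ≤ c + P v` then the oscillation of `v` is bounded independently of `v`. -/
theorem exists_oscillation_bound (c : ℝ) :
    ∃ C : ℝ, ∀ v : Fin S → ℝ, (∀ s, v s ≤ c + ∑ t, M.P s t * v t) → ∀ s t, v s - v t ≤ C := by
  obtain ⟨m, -, hm⟩ := M.ergodic.exists_pos_pow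
  have : Nonempty (Fin S) := ⟨⟨0, M.channels_pos⟩⟩
  obtain ⟨p, hp⟩ := Finite.exists_min fun p : Fin S × Fin S => (M.P ^ m) p.1 p.2
  refine ⟨m * c / (M.P ^ m) p.1 p.2, fun v hv s t => ?_⟩
  have hst : ∀ k, M.P ^ k ∈ Matrix.rowStochastic ℝ (Fin S) := fun k => pow_mem M.stochastic k
  have hiter : ∀ k : ℕ, ∀ s, v s ≤ k * c + ∑ t, (M.P ^ k) s t * v t := by
    intro k
    induction k with
    | zero => intro s; simp [Matrix.one_apply]
    | succ k ih =>
      intro s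
      calc v s ≤ k * c + ∑ t, (M.P ^ k) s t * v t := ih s
        _ ≤ k * c + ∑ t, (M.P ^ k) s t * (c + ∑ u, M.P t u * v u) := by
            gcongr with t
            · exact Matrix.nonneg_of_mem_rowStochastic (hst k)
            · exact hv t
        _ = _ := by
            simp only [mul_add, Finset.sum_add_distrib]
            rw [← Finset.sum_mul, Matrix.sum_row_of_mem_rowStochastic (hst k)]
            simp only [Finset.mul_sum, pow_succ, Matrix.mul_apply, Finset.sum_mul]
            rw [Finset.sum_comm]
            push_cast
            simp only [mul_assoc]
            ring
  obtain ⟨a, ha⟩ := Finite.exists_max v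
  obtain ⟨b, hb⟩ := Finite.exists_min v
  have hpos := hm p.1 p.2
  -- At a maximiser `a`, the drop from `v a` to its `m`-step average is at most `m * c`, and the
  -- minimiser `b` alone contributes at least the least entry of `P ^ m` times the oscillation.
  have hab : (M.P ^ m) p.1 p.2 * (v a - v b) ≤ m * c := by
    have h1 : (M.P ^ m) a b * (v a - v b) ≤ ∑ t, (M.P ^ m) a t * (v a - v t) :=
      Finset.single_le_sum (f := fun t => (M.P ^ m) a t * (v a - v t))
        (fun t _ => mul_nonneg (hm a t).le (sub_nonneg.2 (ha t))) (Finset.mem_univ b)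
    have h2 : ∑ t, (M.P ^ m) a t * (v a - v t) = v a - ∑ t, (M.P ^ m) a t * v t := by
      simp only [mul_sub, Finset.sum_sub_distrib, ← Finset.sum_mul,
        Matrix.sum_row_of_mem_rowStochastic (hst m), one_mul]
    have h3 := mul_le_mul_of_nonneg_right (hp (a, b)) (sub_nonneg.2 (ha b))
    have := hiter m a
    simp only at h3
    linarith
  rw [le_div_iff₀ hpos]
  have := mul_le_mul_of_nonneg_left (sub_le_sub (ha s) (hb t)) hpos.le
  linarith

/-- Relative discounted value functions are bounded uniformly in the discount factor. -/
theorem exists_relative_bound (hη : 0 ≤ η) :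
    ∃ B : ℕ → ℝ, ∀ (α : ℝ) (V : ℕ → Fin S → ℝ), α ≤ 1 → 0 ≤ α → MonoConvex V →
      (∀ l s, 0 ≤ V l s) → M.bellman η α V = V → ∀ l s t, |V l s - V 0 t| ≤ B l := by
  set c := M.sendCost η with hc
  have hc0 := M.sendCost_nonneg hη
  have : Nonempty (Fin S) := ⟨⟨0, M.channels_pos⟩⟩
  obtain ⟨C, hC⟩ := M.exists_oscillation_bound c
  have hθ := M.θ_nonneg
  have hθ' := sub_pos.2 M.θ_lt_one
  -- Always sending lowers the queue from `k + 1` to `k` at the first slot without arrival, after `1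
  -- / (1 - θ)` slots on average, each costing at most `c + k + 1`.
  let b : ℕ → ℝ := fun l => ∑ k ∈ Finset.range l, (c + k + 1) / (1 - M.θ)
  have hb0 : ∀ l, 0 ≤ b l := fun l => Finset.sum_nonneg fun k _ => by positivity
  refine ⟨fun l => b l + C, fun α V hα1 hα hV hV0 hfix l s t => ?_⟩
  have hαV : ∀ l s, α * V l s ≤ V l s := fun l s => mul_le_of_le_one_left (hV0 l s) hα1
  have hosc : ∀ s t, V 0 s - V 0 t ≤ C := by
    refine hC _ fun s => ?_
    -- Sending keeps an empty queue empty even if a packet arrives, so `V 0` satisfies the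
    -- hypothesis of the oscillation bound.
    have hsend : ∀ q ≤ 1, ∀ t, M.stage η (fun l s => α * V l s) q t ≤ V 0 t + c := by
      intro q hq t
      refine (M.stage_le_send _ _ _ _).trans ?_
      have := M.mul_X_le_sendCost hη t
      have := hαV 0 t
      rw [Nat.sub_eq_zero_of_le hq, Nat.cast_zero]
      linarith
    have h1 : V 0 s ≤ M.expect (fun _ t => V 0 t + c) 0 s := by
      conv_lhs => rw [← hfix]
      exact M.expect_mono s (hsend 0 (by omega)) (hsend 1 le_rfl)
    rw [M.expect_add_const (fun _ t => V 0 t)] at h1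
    have h2 : M.expect (fun _ t => V 0 t) 0 s = ∑ t, M.P s t * V 0 t :=
      Finset.sum_congr rfl fun t _ => by ring
    linarith
  obtain ⟨a, ha⟩ := Finite.exists_max (V 0)
  have hup : ∀ l s, V l s ≤ V 0 a + b l := by
    intro l
    induction l with
    | zero => intro s; simpa [b] using ha s
    | succ l ih =>
      obtain ⟨z, hz⟩ := Finite.exists_max (V (l + 1))
      have h1 : V (l + 1) z ≤ M.θ * (c + (l + 1) + V (l + 1) z)
          + (1 - M.θ) * (c + l + (V 0 a + b l)) := by
        conv_lhs => rw [← hfix]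
        refine M.expect_le z ?_ ?_
        · intro t
          refine (M.stage_le_send _ _ _ _).trans ?_
          have := M.mul_X_le_sendCost hη t
          have := hαV l t
          have := ih t
          simp only [Nat.add_sub_cancel]
          linarith
        · intro t
          refine (M.stage_le_send _ _ _ _).trans ?_
          have := M.mul_X_le_sendCost hη t
          have := hαV (l + 1) t
          have := hz t
          simp only [Nat.add_sub_cancel]
          push_cast
          linarith
      have hbs : (1 - M.θ) * b (l + 1) = (1 - M.θ) * b l + (c + l + 1) := by
        simp only [b, Finset.sum_range_succ]
        field_simp
      intro s
      refine (hz s).trans ?_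
      have h2 : (1 - M.θ) * V (l + 1) z ≤ (1 - M.θ) * (V 0 a + b (l + 1)) := by
        rw [mul_add, hbs]
        nlinarith
      exact le_of_mul_le_mul_left h2 hθ'
  have h1 := hup l s
  have h2 := hosc a t
  have h3 := hosc t s
  have h4 : V 0 s ≤ V l s := hV.monotone s (Nat.zero_le l)
  have := hb0 l
  rw [abs_le]
  constructor <;> linarith

/-! ### Average cost optimality equation and growth of its solution -/

/-- Existence of a solution of the average cost optimality equation for the unlimited buffer, by
the vanishing discount method. -/
theorem exists_average_cost_equation (hη : 0 ≤ η) :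
    ∃ (g : ℝ) (h : ℕ → Fin S → ℝ), MonoConvex h ∧ (∃ C, ∀ l s, C ≤ h l s) ∧
      ∀ l s, M.expect (M.stage η h) l s = h l s + g := by
  obtain ⟨B, hB⟩ := M.exists_relative_bound hη
  let s₀ : Fin S := ⟨0, M.channels_pos⟩
  let α : ℕ → ℝ := fun n => 1 - 1 / ((n : ℝ) + 1)
  have hα0 : ∀ n, 0 ≤ α n := fun n => by
    have : 1 / ((n : ℝ) + 1) ≤ 1 := by
      rw [div_le_one (by positivity)]
      linarith [(Nat.cast_nonneg n : (0 : ℝ) ≤ n)]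
    simp only [α]
    linarith
  have hα1 : ∀ n, α n < 1 := fun n => sub_lt_self _ (by positivity)
  have hαlim : Tendsto α atTop (𝓝 1) := by
    simpa [α] using (tendsto_const_nhds (x := (1 : ℝ))).sub tendsto_one_div_add_atTop_nhds_zero_nat
  choose V hV hV0 hVle hfix using fun n => M.exists_discounted hη (hα0 n) (hα1 n)
  let γ : ℕ → ℝ := fun n => (1 - α n) * V n 0 s₀
  let d : ℕ → ℕ → Fin S → ℝ := fun n l s => V n l s - V n 0 s₀
  have hd : ∀ n, MonoConvex (d n) := fun n =>
    ⟨fun l s => by have := (hV n).mono l s; simp only [d]; linarith,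
      fun l s => by have := (hV n).convex l s; simp only [d]; linarith⟩
  have heq : ∀ n l s, M.bellman η (α n) (d n) l s = d n l s + γ n := by
    intro n l s
    have h1 : (fun q t => M.stage η (fun l s => α n * d n l s) q t + α n * V n 0 s₀)
        = M.stage η (fun l s => α n * V n l s) := by
      ext q t
      simp only [stage, d]
      rw [← min_add_add_right]
      congr 1 <;> ring
    have h2 := M.expect_add_const (M.stage η fun l s => α n * d n l s) (α n * V n 0 s₀) l s
    rw [h1] at h2
    have h3 : M.expect (M.stage η fun l s => α n * V n l s) l s = V n l s :=
      congrFun (congrFun (hfix n) l) s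
    simp only [bellman, d, γ] at *
    linarith
  let Q : Set (ℝ × (ℕ → Fin S → ℝ)) := Set.Icc 0 (M.sendCost η) ×ˢ
    Set.pi Set.univ fun l => Set.pi Set.univ fun _ => Set.Icc (-B l) (B l)
  have hQ : IsCompact Q := isCompact_Icc.prod <|
    isCompact_univ_pi fun l => isCompact_univ_pi fun _ => isCompact_Icc
  have hmem : ∀ n, (γ n, d n) ∈ Q := by
    intro n
    refine ⟨⟨mul_nonneg (sub_nonneg.2 (hα1 n).le) (hV0 n 0 s₀), ?_⟩, fun l _ s _ => ?_⟩
    · simpa using hVle n 0 s₀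
    · exact abs_le.1 (hB _ _ (hα1 n).le (hα0 n) (hV n) (hV0 n) (hfix n) l s s₀)
  -- Tychonoff compactness along an ultrafilter replaces a diagonal subsequence.
  obtain ⟨⟨g, h⟩, hgh, hlim⟩ := hQ.ultrafilter_le_nhds
    ((hyperfilter ℕ).map fun n => (γ n, d n))
    (le_principal_iff.2 (mem_map.2 (univ_mem' hmem)))
  have hlim' : Tendsto (fun n => (γ n, d n)) (hyperfilter ℕ : Filter ℕ) (𝓝 (g, h)) := hlim
  have hγ : Tendsto γ (hyperfilter ℕ : Filter ℕ) (𝓝 g) := (continuous_fst.tendsto _).comp hlim'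
  have hdl : Tendsto d (hyperfilter ℕ : Filter ℕ) (𝓝 h) := (continuous_snd.tendsto _).comp hlim'
  have hα : Tendsto α (hyperfilter ℕ : Filter ℕ) (𝓝 1) :=
    hαlim.mono_left (Nat.cofinite_eq_atTop ▸ hyperfilter_le_cofinite)
  have hreg : MonoConvex h := isClosed_monoConvex.mem_of_tendsto hdl (Eventually.of_forall hd)
  refine ⟨g, h, hreg, ⟨-B 0, fun l s => ?_⟩, fun l s => ?_⟩
  · exact (hgh.2 0 trivial s trivial).1.trans (hreg.monotone s (Nat.zero_le l))
  · have h1 := ((M.continuous_bellman η).tendsto (1, h)).comp (hα.prodMk_nhds hdl)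
    have h2 := tendsto_pi_nhds.1 (tendsto_pi_nhds.1 h1 l) s
    have h3 := (tendsto_pi_nhds.1 (tendsto_pi_nhds.1 hdl l) s).add hγ
    have h4 := tendsto_nhds_unique h2 (h3.congr fun n => (heq n l s).symm)
    simpa [bellman] using h4

/-- At `q + 1`, use the action that is optimal at `q + 2`; convexity of `h` covers idling. -/
theorem stage_growth {h : ℕ → Fin S → ℝ} (hh : MonoConvex h) (q : ℕ) (s : Fin S) :
    1 + (h (q + 1) s - h q s) ≤ M.stage η h (q + 2) s - M.stage η h (q + 1) s := by
  have h1 := M.stage_le_send η h (q + 1) s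
  have h2 := M.stage_le_idle η h (q + 1) s
  have h3 : M.stage η h (q + 2) s = η * M.X s + (((q + 1 : ℕ) : ℝ) + h (q + 1) s) ∨
      M.stage η h (q + 2) s = ((q + 2 : ℕ) : ℝ) + h (q + 2) s := min_choice _ _
  have := hh.convex q s
  simp only [Nat.add_sub_cancel] at h1
  push_cast at *
  rcases h3 with h3 | h3 <;> linarith

/-- The increments of a solution of the average cost optimality equation grow linearly. -/
theorem le_increment {h : ℕ → Fin S → ℝ} {g : ℝ} (hh : MonoConvex h)
    (heq : ∀ l s, M.expect (M.stage η h) l s = h l s + g) (l : ℕ) (s : Fin S) :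
    (l : ℝ) ≤ h (l + 1) s - h l s := by
  have : Nonempty (Fin S) := ⟨s⟩
  have hθ := M.θ_nonneg
  have hθ' := sub_pos.2 M.θ_lt_one
  induction l generalizing s with
  | zero => simpa using hh.mono 0 s
  | succ l ih =>
    obtain ⟨z, hz⟩ := Finite.exists_min fun s => h (l + 2) s - h (l + 1) s
    refine le_trans ?_ (hz s)
    have h1 := M.expect_sub (M.stage η h) 1 (l + 1) z
    rw [heq, heq] at h1
    -- Without arrival the induction hypothesis gives `1 + l`; with arrival, minimality of `z`
    -- returns the unknown increment itself, absorbed on the left since `θ < 1`.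
    have h2 := M.le_expect (G := fun q t => M.stage η h (q + 1) t - M.stage η h q t) (l := l + 1) z
      (c₀ := 1 + l) (c₁ := 1 + (h (l + 2) z - h (l + 1) z))
      (fun t => by have := M.stage_growth (η := η) hh l t; have := ih t; linarith)
      (fun t => by
        have := M.stage_growth (η := η) hh (l + 1) t
        have h5 := hz t
        simp only [add_assoc, Nat.reduceAdd] at *
        linarith)
    rw [← h1] at h2
    simp only [add_assoc, Nat.reduceAdd] at h2
    have h3 : (1 - M.θ) * (l + 1) ≤ (1 - M.θ) * (h (l + 2) z - h (l + 1) z) := by nlinarith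
    push_cast
    exact le_of_mul_le_mul_left h3 hθ'

end LinkModel

/-! ### Pathwise comparison of queues -/

theorem queueAfter_append {S : ℕ} (K : ℕ∞) (l₀ : ℕ) (h : List (Slot S)) (x : Slot S) :
    queueAfter K l₀ (h ++ [x]) = queueStep K (queueAfter K l₀ h) x.2.1.toNat x.2.2.toNat := by
  simp [queueAfter]

theorem channelAfter_append {S : ℕ} (s₀ : Fin S) (h : List (Slot S)) (x : Slot S) :
    channelAfter s₀ (h ++ [x]) = x.1 := by
  simp [channelAfter]

theorem queueStep_le (K : ℕ∞) (l b a : ℕ) : queueStep K l b a ≤ l + b - a := by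
  refine Nat.sub_le_sub_right ?_ a
  exact (ENat.toNat_le_toNat (min_le_left ((l + b : ℕ) : ℕ∞) K) (ENat.natCast_ne_top _)).trans_eq
    (ENat.toNat_natCast _)

theorem queueStep_natCast (K l b a : ℕ) : queueStep K l b a = min (l + b) K - a := by
  unfold queueStep
  rcases le_total (l + b) K with h | h
  · rw [min_eq_left h, min_eq_left (by exact_mod_cast h), ENat.toNat_natCast]
  · rw [min_eq_right h, min_eq_right (by exact_mod_cast h), ENat.toNat_natCast]

theorem queueStep_mono {K K' : ℕ∞} (hK : K ≤ K') {l l' : ℕ} (hl : l ≤ l') (b a : ℕ) :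
    queueStep K l b a ≤ queueStep K' l' b a := by
  refine Nat.sub_le_sub_right (ENat.toNat_le_toNat ?_ ?_) a
  · exact min_le_min (by exact_mod_cast Nat.add_le_add_right hl b) hK
  · exact ne_top_of_le_ne_top (ENat.natCast_ne_top _) (min_le_left _ _)

theorem queueAfter_mono {S : ℕ} {K K' : ℕ∞} (hK : K ≤ K') {l l' : ℕ} (hl : l ≤ l')
    (h : List (Slot S)) : queueAfter K l h ≤ queueAfter K' l' h := by
  induction h using List.reverseRecOn with
  | nil => exact hl
  | append_singleton h x ih =>
    rw [queueAfter_append, queueAfter_append]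
    exact queueStep_mono hK ih _ _

/-! ### Path probabilities and drift bounds -/

namespace LinkModel

variable {S : ℕ} (M : LinkModel S) (K : ℕ∞) (π : Policy S) (l₀ : ℕ) (s₀ : Fin S)

/-- The cost of the slot `x` after the slots `h`. -/
noncomputable def slotCost (η 𝓔 : ℝ) (h : List (Slot S)) (x : Slot S) : ℝ :=
  (queueAfter K l₀ (h ++ [x]) : ℝ) + η * ((if x.2.2 then M.X x.1 else 0) - 𝓔)

theorem sum_stepProb_mul (h : List (Slot S)) (F : Slot S → ℝ) :
    ∑ x, M.stepProb K π l₀ s₀ h x * F x = ∑ t, M.P (channelAfter s₀ h) t *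
      (M.θ * ((π h (queueAfter K l₀ h + 1) t : ℝ) * F (t, true, true)
          + (1 - (π h (queueAfter K l₀ h + 1) t : ℝ)) * F (t, true, false))
        + (1 - M.θ) * ((π h (queueAfter K l₀ h) t : ℝ) * F (t, false, true)
          + (1 - (π h (queueAfter K l₀ h) t : ℝ)) * F (t, false, false))) := by
  simp only [Fintype.sum_prod_type, Fintype.sum_bool, stepProb, if_true, Bool.toNat_true,
    Bool.toNat_false, add_zero, Bool.false_eq_true, if_false]
  exact Finset.sum_congr rfl fun t _ => by ring

theorem sum_stepProb (h : List (Slot S)) : ∑ x, M.stepProb K π l₀ s₀ h x = 1 := by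
  have := M.sum_stepProb_mul K π l₀ s₀ h fun _ => 1
  simp only [mul_one] at this
  rw [this]
  refine Eq.trans ?_ (Matrix.sum_row_of_mem_rowStochastic M.stochastic (channelAfter s₀ h))
  exact Finset.sum_congr rfl fun t _ => by ring

theorem stepProb_nonneg (h : List (Slot S)) (x : Slot S) : 0 ≤ M.stepProb K π l₀ s₀ h x := by
  have hp := (π h (queueAfter K l₀ h + x.2.1.toNat) x.1).2
  have h0 := M.θ_nonneg
  have h1 := M.θ_lt_one
  refine mul_nonneg (mul_nonneg (M.ergodic.nonneg _ _) ?_) ?_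
  · split_ifs <;> linarith
  · split_ifs <;> linarith [hp.1, hp.2]

theorem pathProb_nonneg {N : ℕ} (ω : Fin N → Slot S) : 0 ≤ M.pathProb K π l₀ s₀ ω :=
  Finset.prod_nonneg fun _ _ => M.stepProb_nonneg K π l₀ s₀ _ _

theorem ofFn_snoc {N : ℕ} (ω : Fin N → Slot S) (x : Slot S) :
    List.ofFn (Fin.snoc ω x : Fin (N + 1) → Slot S) = List.ofFn ω ++ [x] := by
  rw [List.ofFn_succ_last]
  simp

theorem pathProb_snoc {N : ℕ} (ω : Fin N → Slot S) (x : Slot S) :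
    M.pathProb K π l₀ s₀ (Fin.snoc ω x : Fin (N + 1) → Slot S)
      = M.pathProb K π l₀ s₀ ω * M.stepProb K π l₀ s₀ (List.ofFn ω) x := by
  unfold pathProb
  rw [Fin.prod_univ_castSucc, ofFn_snoc]
  congr 1
  · refine Finset.prod_congr rfl fun n _ => ?_
    rw [List.take_append_of_le_length (by simp [n.2.le]), Fin.snoc_castSucc, Fin.val_castSucc]
  · rw [List.take_append_of_le_length (by simp), List.take_of_length_le (by simp), Fin.snoc_last]

theorem pathCost_snoc (η 𝓔 : ℝ) {N : ℕ} (ω : Fin N → Slot S) (x : Slot S) :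
    M.pathCost K η 𝓔 l₀ (Fin.snoc ω x : Fin (N + 1) → Slot S)
      = M.pathCost K η 𝓔 l₀ ω + M.slotCost K l₀ η 𝓔 (List.ofFn ω) x := by
  unfold pathCost slotCost
  rw [Fin.sum_univ_castSucc, ofFn_snoc]
  congr 1
  · refine Finset.sum_congr rfl fun n _ => ?_
    rw [List.take_append_of_le_length (by simp), Fin.snoc_castSucc, Fin.val_castSucc]
  · rw [List.take_of_length_le (by simp), Fin.snoc_last]

theorem sum_fin_succ {N : ℕ} (F : (Fin (N + 1) → Slot S) → ℝ) :
    ∑ ω, F ω = ∑ ω : Fin N → Slot S, ∑ x, F (Fin.snoc ω x) := by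
  rw [← (Fin.snocEquiv fun _ => Slot S).sum_comp, Fintype.sum_prod_type, Finset.sum_comm]
  rfl

theorem sum_pathProb (N : ℕ) : ∑ ω : Fin N → Slot S, M.pathProb K π l₀ s₀ ω = 1 := by
  induction N with
  | zero => simp [pathProb]
  | succ N ih =>
    simp only [sum_fin_succ, pathProb_snoc, ← Finset.mul_sum, sum_stepProb, mul_one, ih]

/-- The expected total cost of the slots `1, …, N` plus the expected potential afterwards. -/
noncomputable def potentialCost (η 𝓔 : ℝ) (Φ : List (Slot S) → ℝ) (N : ℕ) : ℝ :=
  ∑ ω : Fin N → Slot S, M.pathProb K π l₀ s₀ ω * (M.pathCost K η 𝓔 l₀ ω + Φ (List.ofFn ω))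

theorem potentialCost_succ (η 𝓔 : ℝ) (Φ : List (Slot S) → ℝ) (N : ℕ) :
    M.potentialCost K π l₀ s₀ η 𝓔 Φ (N + 1) = ∑ ω : Fin N → Slot S, M.pathProb K π l₀ s₀ ω *
      (M.pathCost K η 𝓔 l₀ ω + ∑ x, M.stepProb K π l₀ s₀ (List.ofFn ω) x *
        (M.slotCost K l₀ η 𝓔 (List.ofFn ω) x + Φ (List.ofFn ω ++ [x]))) := by
  rw [potentialCost, sum_fin_succ]
  refine Finset.sum_congr rfl fun ω _ => ?_
  simp only [pathProb_snoc, pathCost_snoc, ofFn_snoc]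
  conv_rhs => rw [← one_mul (M.pathCost K η 𝓔 l₀ ω), ← M.sum_stepProb K π l₀ s₀ (List.ofFn ω)]
  rw [Finset.sum_mul, ← Finset.sum_add_distrib, Finset.mul_sum]
  exact Finset.sum_congr rfl fun x _ => by ring

theorem potentialCost_add (η 𝓔 g : ℝ) (Φ : List (Slot S) → ℝ) (N : ℕ) :
    M.potentialCost K π l₀ s₀ η 𝓔 Φ N + g = ∑ ω : Fin N → Slot S, M.pathProb K π l₀ s₀ ω *
      (M.pathCost K η 𝓔 l₀ ω + (g + Φ (List.ofFn ω))) := by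
  conv_lhs => rw [← one_mul g, ← M.sum_pathProb K π l₀ s₀ N]
  rw [potentialCost, Finset.sum_mul, ← Finset.sum_add_distrib]
  exact Finset.sum_congr rfl fun x _ => by ring

/-- The drift condition makes accumulated cost plus potential minus `g` per slot a submartingale.
The potential may depend on the whole history, as the virtual queue requires. -/
theorem le_potentialCost {η 𝓔 g : ℝ} {Φ : List (Slot S) → ℝ}
    (hΦ : ∀ h, g + Φ h ≤ ∑ x, M.stepProb K π l₀ s₀ h x *
      (M.slotCost K l₀ η 𝓔 h x + Φ (h ++ [x]))) (N : ℕ) :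
    N * g + Φ [] ≤ M.potentialCost K π l₀ s₀ η 𝓔 Φ N := by
  induction N with
  | zero => simp [potentialCost, pathProb, pathCost]
  | succ N ih =>
    have : M.potentialCost K π l₀ s₀ η 𝓔 Φ N + g ≤ M.potentialCost K π l₀ s₀ η 𝓔 Φ (N + 1) := by
      rw [potentialCost_add, potentialCost_succ]
      gcongr with ω
      · exact M.pathProb_nonneg K π l₀ s₀ ω
      · exact hΦ _
    push_cast
    linarith

theorem potentialCost_le {η 𝓔 g : ℝ} {Φ : List (Slot S) → ℝ}
    (hΦ : ∀ h, ∑ x, M.stepProb K π l₀ s₀ h x *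
      (M.slotCost K l₀ η 𝓔 h x + Φ (h ++ [x])) ≤ g + Φ h) (N : ℕ) :
    M.potentialCost K π l₀ s₀ η 𝓔 Φ N ≤ N * g + Φ [] := by
  induction N with
  | zero => simp [potentialCost, pathProb, pathCost]
  | succ N ih =>
    have : M.potentialCost K π l₀ s₀ η 𝓔 Φ (N + 1) ≤ M.potentialCost K π l₀ s₀ η 𝓔 Φ N + g := by
      rw [potentialCost_add, potentialCost_succ]
      gcongr with ω
      · exact M.pathProb_nonneg K π l₀ s₀ ω
      · exact hΦ _
    push_cast
    linarith

theorem potentialCost_eq (η 𝓔 : ℝ) (Φ : List (Slot S) → ℝ) {N : ℕ} (hN : N ≠ 0) :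
    M.potentialCost K π l₀ s₀ η 𝓔 Φ N = N * M.avgCost K η 𝓔 π l₀ s₀ N
      + ∑ ω : Fin N → Slot S, M.pathProb K π l₀ s₀ ω * Φ (List.ofFn ω) := by
  have hN' : (N : ℝ) ≠ 0 := Nat.cast_ne_zero.2 hN
  simp only [potentialCost, avgCost, mul_add, Finset.sum_add_distrib]
  rw [mul_div_cancel₀ _ hN']

/-- A bounded-above potential with nonnegative drift bounds the average cost from below. -/
theorem le_avgCost {η 𝓔 g C : ℝ} {Φ : List (Slot S) → ℝ}
    (hΦ : ∀ h, g + Φ h ≤ ∑ x, M.stepProb K π l₀ s₀ h x *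
      (M.slotCost K l₀ η 𝓔 h x + Φ (h ++ [x]))) (hC : ∀ h, Φ h ≤ C) {N : ℕ} (hN : N ≠ 0) :
    g + (Φ [] - C) / N ≤ M.avgCost K η 𝓔 π l₀ s₀ N := by
  have h1 := M.le_potentialCost K π l₀ s₀ hΦ N
  rw [M.potentialCost_eq K π l₀ s₀ η 𝓔 Φ hN] at h1
  have h2 : ∑ ω : Fin N → Slot S, M.pathProb K π l₀ s₀ ω * Φ (List.ofFn ω) ≤ C := by
    conv_rhs => rw [← one_mul C, ← M.sum_pathProb K π l₀ s₀ N, Finset.sum_mul]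
    gcongr with ω
    · exact M.pathProb_nonneg K π l₀ s₀ ω
    · exact hC _
  have hN' : (0 : ℝ) < N := Nat.cast_pos.2 (Nat.pos_of_ne_zero hN)
  rw [← sub_nonneg]
  have : 0 ≤ (N * M.avgCost K η 𝓔 π l₀ s₀ N - (N * g + (Φ [] - C))) / N :=
    div_nonneg (by linarith) hN'.le
  convert this using 1
  field_simp

/-- A bounded-below potential with nonpositive drift bounds the average cost from above. -/
theorem avgCost_le {η 𝓔 g C : ℝ} {Φ : List (Slot S) → ℝ}
    (hΦ : ∀ h, ∑ x, M.stepProb K π l₀ s₀ h x *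
      (M.slotCost K l₀ η 𝓔 h x + Φ (h ++ [x])) ≤ g + Φ h) (hC : ∀ h, C ≤ Φ h)
    {N : ℕ} (hN : N ≠ 0) :
    M.avgCost K η 𝓔 π l₀ s₀ N ≤ g + (Φ [] - C) / N := by
  have h1 := M.potentialCost_le K π l₀ s₀ hΦ N
  rw [M.potentialCost_eq K π l₀ s₀ η 𝓔 Φ hN] at h1
  have h2 : C ≤ ∑ ω : Fin N → Slot S, M.pathProb K π l₀ s₀ ω * Φ (List.ofFn ω) := by
    conv_lhs => rw [← one_mul C, ← M.sum_pathProb K π l₀ s₀ N, Finset.sum_mul]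
    gcongr with ω
    · exact M.pathProb_nonneg K π l₀ s₀ ω
    · exact hC _
  have hN' : (0 : ℝ) < N := Nat.cast_pos.2 (Nat.pos_of_ne_zero hN)
  rw [← sub_nonneg]
  have : 0 ≤ (N * g + (Φ [] - C) - N * M.avgCost K η 𝓔 π l₀ s₀ N) / N :=
    div_nonneg (by linarith) hN'.le
  convert this using 1
  field_simp

end LinkModel

/-! ### The threshold rule and the two cost bounds -/

namespace LinkModel

variable {S : ℕ} (M : LinkModel S) {η : ℝ}

open Classical in
/-- The rule that sends exactly when this is at most as costly as idling, and the queue is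
nonempty. -/
noncomputable def greedyRule (η : ℝ) (h : ℕ → Fin S → ℝ) (q : ℕ) (s : Fin S) : Bool :=
  decide (q ≠ 0 ∧ η * M.X s ≤ 1 + (h q s - h (q - 1) s))

theorem greedyRule_cost_le (hη : 0 ≤ η) (h : ℕ → Fin S → ℝ) (q : ℕ) (s : Fin S) :
    ((q - (M.greedyRule η h q s).toNat : ℕ) : ℝ)
      + η * (if M.greedyRule η h q s then M.X s else 0)
      + h (q - (M.greedyRule η h q s).toNat) s ≤ M.stage η h q s := by
  by_cases hf : q ≠ 0 ∧ η * M.X s ≤ 1 + (h q s - h (q - 1) s)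
  · have h1 : M.greedyRule η h q s = true := decide_eq_true hf
    obtain ⟨k, rfl⟩ := Nat.exists_eq_succ_of_ne_zero hf.1
    have := hf.2
    simp only [h1, Bool.toNat_true, if_true]
    refine le_min (by linarith) ?_
    simp only [Nat.succ_eq_add_one, Nat.add_sub_cancel] at *
    push_cast
    linarith
  · have h1 : M.greedyRule η h q s = false := decide_eq_false hf
    simp only [h1, Bool.toNat_false, Nat.sub_zero, Bool.false_eq_true, if_false, mul_zero, add_zero]
    refine le_min ?_ le_rfl
    rcases q with _ | q
    · have := mul_nonneg hη (M.X_nonneg s)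
      simp only [Nat.zero_sub]
      linarith
    · have := not_le.1 fun h2 => hf ⟨q.succ_ne_zero, h2⟩
      simp only [Nat.add_sub_cancel] at *
      push_cast
      linarith

/-- For a value function that is convex with unbounded increments, the greedy rule is a threshold
rule. -/
theorem exists_threshold {h : ℕ → Fin S → ℝ} (hh : MonoConvex h)
    (hinc : ∀ (l : ℕ) s, (l : ℝ) ≤ h (l + 1) s - h l s) :
    ∃ L : Fin S → ℕ, ∀ q s, M.greedyRule η h q s = true ↔ L s ≤ q := by
  classical
  -- Unbounded increments make the threshold finite.
  have hex : ∀ s, ∃ q, M.greedyRule η h q s = true := by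
    intro s
    obtain ⟨n, hn⟩ := exists_nat_ge (η * M.X s)
    refine ⟨n + 1, decide_eq_true ⟨n.succ_ne_zero, ?_⟩⟩
    have := hinc n s
    simp only [Nat.add_sub_cancel]
    linarith
  refine ⟨fun s => Nat.find (hex s), fun q s => ⟨fun hq => Nat.find_min' _ hq, fun hq => ?_⟩⟩
  induction q, hq using Nat.le_induction with
  | base => exact Nat.find_spec (hex s)
  | succ q _ ih =>
    obtain ⟨h0, h1⟩ := of_decide_eq_true ih
    refine decide_eq_true ⟨q.succ_ne_zero, h1.trans ?_⟩
    obtain ⟨k, rfl⟩ := Nat.exists_eq_succ_of_ne_zero h0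
    have := hh.convex k s
    change 1 + (h (k + 1) s - h k s) ≤ 1 + (h (k + 2) s - h (k + 1) s)
    linarith

/-- The threshold rule has long-run average cost at most `g - η 𝓔`, for every buffer size. -/
theorem avgCost_greedyRule_le (hη : 0 ≤ η) {h : ℕ → Fin S → ℝ} {g C : ℝ} (hh : MonoConvex h)
    (hC : ∀ l s, C ≤ h l s) (heq : ∀ l s, M.expect (M.stage η h) l s = h l s + g)
    (K : ℕ∞) (𝓔 : ℝ) (l₀ : ℕ) (s₀ : Fin S) {N : ℕ} (hN : N ≠ 0) :
    M.avgCost K η 𝓔 (Policy.ofRule (M.greedyRule η h)) l₀ s₀ N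
      ≤ g - η * 𝓔 + (h l₀ s₀ - C) / N := by
  refine M.avgCost_le K _ l₀ s₀
    (Φ := fun w => h (queueAfter K l₀ w) (channelAfter s₀ w)) (fun w => ?_) (fun w => hC _ _) hN
  rw [sum_stepProb_mul]
  set l := queueAfter K l₀ w
  have hθ := M.θ_nonneg
  have hθ' := sub_nonneg.2 M.θ_lt_one.le
  have key : ∀ (b : Bool) t,
      M.slotCost K l₀ η 𝓔 w (t, b, M.greedyRule η h (l + b.toNat) t)
        + h (queueAfter K l₀ (w ++ [(t, b, M.greedyRule η h (l + b.toNat) t)])) t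
      ≤ M.stage η h (l + b.toNat) t + -(η * 𝓔) := by
    intro b t
    have h1 := M.greedyRule_cost_le hη h (l + b.toNat) t
    -- Overflow can only lower the queue cost and, by monotonicity, `h`.
    have h2 := queueStep_le K l b.toNat (M.greedyRule η h (l + b.toNat) t).toNat
    have h3 := hh.monotone t h2
    have h4 : ((queueStep K l b.toNat (M.greedyRule η h (l + b.toNat) t).toNat : ℕ) : ℝ) ≤ _ :=
      Nat.cast_le.2 h2
    simp only [slotCost, queueAfter_append, mul_sub] at *
    linarith
  have hrule : ∀ (q : ℕ) (t : Fin S) (F : Bool → ℝ),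
      (Policy.ofRule (M.greedyRule η h) w q t : ℝ) * F true
        + (1 - (Policy.ofRule (M.greedyRule η h) w q t : ℝ)) * F false
      = F (M.greedyRule η h q t) := by
    intro q t F
    unfold Policy.ofRule
    cases M.greedyRule η h q t <;> simp
  calc _ ≤ M.expect (fun q t => M.stage η h q t + -(η * 𝓔)) l (channelAfter s₀ w) := by
        unfold expect
        simp only [channelAfter_append]
        refine Finset.sum_le_sum fun t _ => mul_le_mul_of_nonneg_left
          (add_le_add (mul_le_mul_of_nonneg_left ?_ hθ) (mul_le_mul_of_nonneg_left ?_ hθ'))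
          (M.P_nonneg _ t)
        · exact (hrule (l + 1) t fun a => M.slotCost K l₀ η 𝓔 w (t, true, a)
            + h (queueAfter K l₀ (w ++ [(t, true, a)])) t).trans_le (key true t)
        · exact (hrule l t fun a => M.slotCost K l₀ η 𝓔 w (t, false, a)
            + h (queueAfter K l₀ (w ++ [(t, false, a)])) t).trans_le (key false t)
    _ = _ := by rw [M.expect_add_const (M.stage η h), heq]; ring

/-- The value function of the buffer of size `k`, if sending is optimal at a full buffer. -/
noncomputable def truncValue (η : ℝ) (h : ℕ → Fin S → ℝ) (g : ℝ) (k : ℕ) (l : ℕ) (s : Fin S) : ℝ :=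
  M.expect (fun q t => M.stage η h (min q k) t) l s - g

/-- Below `n + 2` one arrival cannot overflow, so `truncValue` equals `h` there. Only idling at the
full buffer needs an argument: the jump of `truncValue` there is at least `(1 - θ) * n`, which pays
for a transmission. -/
theorem stage_le_truncValue {h : ℕ → Fin S → ℝ} {g : ℝ} (hh : MonoConvex h)
    (heq : ∀ l s, M.expect (M.stage η h) l s = h l s + g)
    (hinc : ∀ (l : ℕ) s, (l : ℝ) ≤ h (l + 1) s - h l s) {n : ℕ}
    (hn : ∀ s, η * M.X s ≤ (1 - M.θ) * n) {q : ℕ} (hq : q ≤ n + 2) (a : Bool) (s : Fin S) :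
    M.stage η h q s ≤ ((q - a.toNat : ℕ) : ℝ) + η * (if a then M.X s else 0)
      + M.truncValue η h g (n + 2) (q - a.toNat) s := by
  have hlt : ∀ l < n + 2, M.truncValue η h g (n + 2) l s = h l s := by
    intro l hl
    have : M.truncValue η h g (n + 2) l s = M.expect (M.stage η h) l s - g := by
      simp only [truncValue, expect]
      rw [min_eq_left hl.le, min_eq_left (Nat.succ_le_of_lt hl)]
    rw [this, heq]
    ring
  cases a
  · simp only [Bool.toNat_false, Nat.sub_zero, Bool.false_eq_true, if_false, mul_zero, add_zero]
    rcases hq.lt_or_eq with hq | rfl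
    · rw [hlt q hq]
      exact M.stage_le_idle η h q s
    · have h1 : (1 - M.θ) * n ≤ M.truncValue η h g (n + 2) (n + 2) s - h (n + 1) s := by
        rw [← hlt (n + 1) (by omega)]
        unfold truncValue
        rw [sub_sub_sub_cancel_right, M.expect_sub _ 1 (n + 1) s]
        -- After an arrival both backlogs are capped at `n + 2` and the difference vanishes; only
        -- slots without arrival contribute.
        have := M.le_expect
          (G := fun q t => M.stage η h (min (q + 1) (n + 2)) t - M.stage η h (min q (n + 2)) t)
          (l := n + 1) s (c₀ := n) (c₁ := 0)
          (fun t => by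
            rw [min_eq_left (by omega), min_eq_left (by omega)]
            have := M.stage_growth (η := η) hh n t
            have := hinc n t
            linarith)
          (fun t => by
            rw [min_eq_right (by omega), min_eq_right (by omega), sub_self])
        linarith
      have h2 := M.stage_le_send η h (n + 2) s
      have h3 := hn s
      simp only [show n + 2 - 1 = n + 1 by omega] at h2
      push_cast at *
      linarith
  · simp only [Bool.toNat_true, if_true]
    rw [hlt (q - 1) (by omega)]
    have := M.stage_le_send η h q s
    linarith

theorem exists_truncValue_le (hη : 0 ≤ η) {h : ℕ → Fin S → ℝ} (hh : MonoConvex h) (g : ℝ) (k : ℕ) :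
    ∃ C, ∀ l s, M.truncValue η h g k l s ≤ C := by
  have hle : ∀ q t, M.stage η h (min q k) t ≤ ∑ t, |M.stage η h k t| := fun q t =>
    ((hh.stage hη).monotone t (min_le_right q k)).trans <| (le_abs_self _).trans <|
      Finset.single_le_sum (f := fun t => |M.stage η h k t|) (fun _ _ => abs_nonneg _)
        (Finset.mem_univ t)
  refine ⟨∑ t, |M.stage η h k t| - g, fun l s => sub_le_sub_right ?_ g⟩
  have := M.expect_le (G := fun q t => M.stage η h (min q k) t) (l := l) s
    (fun t => hle l t) (fun t => hle (l + 1) t)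
  linarith

/-- No policy has long-run average cost below `g - η 𝓔`, if the buffer is large enough. -/
theorem le_avgCost_of_le {h : ℕ → Fin S → ℝ} {g C : ℝ} (hh : MonoConvex h)
    (heq : ∀ l s, M.expect (M.stage η h) l s = h l s + g)
    (hinc : ∀ (l : ℕ) s, (l : ℝ) ≤ h (l + 1) s - h l s) {n : ℕ}
    (hn : ∀ s, η * M.X s ≤ (1 - M.θ) * n)
    (hC : ∀ l s, M.truncValue η h g (n + 2) l s ≤ C) {K : ℕ∞} (hK : ((n + 2 : ℕ) : ℕ∞) ≤ K)
    (𝓔 : ℝ) (π : Policy S) (l₀ : ℕ) (s₀ : Fin S) {N : ℕ} (hN : N ≠ 0) :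
    g - η * 𝓔 + (M.truncValue η h g (n + 2) 0 s₀ - C) / N ≤ M.avgCost K η 𝓔 π l₀ s₀ N := by
  -- This virtual queue uses the actions of the real one. The policy decides from the real backlog,
  -- which is harmless: the inequality `key` holds for both actions, hence for any mixture.
  let Φ : List (Slot S) → ℝ := fun w =>
    M.truncValue η h g (n + 2) (queueAfter (n + 2 : ℕ) 0 w) (channelAfter s₀ w)
  refine M.le_avgCost K π l₀ s₀ (Φ := Φ) (fun w => ?_) (fun w => hC _ _) hN
  rw [sum_stepProb_mul]
  set l := queueAfter K l₀ w
  set k := queueAfter (n + 2 : ℕ) 0 w with hk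
  have hθ := M.θ_nonneg
  have hθ' := sub_nonneg.2 M.θ_lt_one.le
  have key : ∀ (b a : Bool) t, M.stage η h (min (k + b.toNat) (n + 2)) t + -(η * 𝓔)
      ≤ M.slotCost K l₀ η 𝓔 w (t, b, a) + Φ (w ++ [(t, b, a)]) := by
    intro b a t
    have h1 := M.stage_le_truncValue hh heq hinc hn (min_le_right (k + b.toNat) (n + 2)) a t
    have h2 : ((queueAfter (n + 2 : ℕ) 0 (w ++ [(t, b, a)]) : ℕ) : ℝ)
        ≤ queueAfter K l₀ (w ++ [(t, b, a)]) :=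
      Nat.cast_le.2 (queueAfter_mono hK (Nat.zero_le l₀) _)
    have h3 : queueAfter (n + 2 : ℕ) 0 (w ++ [(t, b, a)])
        = min (k + b.toNat) (n + 2) - a.toNat := by
      rw [queueAfter_append, queueStep_natCast]
    simp only [Φ, slotCost, channelAfter_append, mul_sub, h3] at *
    linarith
  have mix : ∀ (p : unitInterval) {c x y : ℝ}, c ≤ x → c ≤ y →
      c ≤ (p : ℝ) * x + (1 - (p : ℝ)) * y := by
    intro p c x y hx hy
    have h1 := mul_le_mul_of_nonneg_left hx p.2.1
    have h2 := mul_le_mul_of_nonneg_left hy (sub_nonneg.2 p.2.2)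
    linarith
  calc _ = M.expect (fun q t => M.stage η h (min q (n + 2)) t + -(η * 𝓔)) k
          (channelAfter s₀ w) := by
        rw [M.expect_add_const (fun q t => M.stage η h (min q (n + 2)) t)]
        simp only [Φ, truncValue, ← hk]
        ring
    _ ≤ _ := by
        unfold expect
        gcongr with t
        · exact M.P_nonneg _ t
        · exact mix _ (key true true t) (key true false t)
        · exact mix _ (key false true t) (key false false t)

end LinkModel

theorem theorem1 {S : ℕ} (M : LinkModel S) (η 𝓔 : ℝ) (hη : 0 ≤ η) :
    ∃ (f : ℕ → Fin S → Bool) (L : Fin S → ℕ) (K₀ : ℕ),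
      (∀ q s, f q s = true ↔ L s ≤ q) ∧
      ∀ K : ℕ∞, (K₀ : ℕ∞) ≤ K → M.IsAverageOptimal K η 𝓔 (Policy.ofRule f) := by
  obtain ⟨g, h, hh, ⟨C, hC⟩, heq⟩ := M.exists_average_cost_equation hη
  have hinc := M.le_increment hh heq
  obtain ⟨L, hL⟩ := M.exists_threshold (η := η) hh hinc
  have hθ := sub_pos.2 M.θ_lt_one
  obtain ⟨n, hn⟩ := exists_nat_ge (M.sendCost η / (1 - M.θ))
  have hn' : ∀ s, η * M.X s ≤ (1 - M.θ) * n := fun s => by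
    rw [div_le_iff₀ hθ] at hn
    linarith [M.mul_X_le_sendCost hη s]
  obtain ⟨C', hC'⟩ := M.exists_truncValue_le hη hh g (n + 2)
  refine ⟨M.greedyRule η h, L, n + 2, hL, fun K hK l₀ s₀ _ => ⟨g - η * 𝓔, ?_, fun π => ?_⟩⟩
  all_goals
    have hlim : ∀ c : ℝ, Tendsto (fun N : ℕ => g - η * 𝓔 + c / N) atTop (𝓝 (g - η * 𝓔)) :=
      fun c => by simpa using tendsto_const_nhds.add (tendsto_const_div_atTop_nhds_zero_nat c)
    have hlow := fun π => (eventually_ne_atTop 0).mono fun N hN =>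
      M.le_avgCost_of_le hh heq hinc hn' hC' hK 𝓔 π l₀ s₀ (N := N) hN
  -- The lower bound, applied to the threshold rule itself, gives convergence by squeezing.
  · exact tendsto_of_tendsto_of_tendsto_of_le_of_le' (hlim _) (hlim _) (hlow _)
      ((eventually_ne_atTop 0).mono fun N hN =>
        M.avgCost_greedyRule_le hη hh hC heq K 𝓔 l₀ s₀ hN)
  · have h1 := (continuous_coe_real_ereal.tendsto _).comp
      (hlim (M.truncValue η h g (n + 2) 0 s₀ - C'))
    rw [← h1.liminf_eq]
    exact liminf_le_liminf ((hlow π).mono fun N hN => EReal.coe_le_coe_iff.2 hN)
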